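/- Let $M$ be a matroid on a finite ground set $E$. A flat $F$ of $M$ is called \emph{cyclic} if it is equal to the union of all circuits of $M$ contained in $F$ (so the empty set is a cyclic flat whenever it is a flat), and $M$ is called \emph{nested} if its cyclic flats form a chain under inclusion. Let $N_{r,n}$ denote the number of loopfree nested matroids of rank $r$ on the ground set $\{1,\dots,n\}$, where matroids are counted as labeled objects (not up to isomorphism). For $n\ge 1$ and $0\le k<n$, let the Eulerian number $A_{k,n}$ be the number of permutations $\sigma$ of $\{1,\dots,n\}$ with exactly $k$ ascents, an ascent being an index $i\in\{1,\dots,n-1\}$ with $\sigma(i)<\sigma(i+1)$. \textbf{Theorem.} For all integers $n\ge 1$ and $1\le r\le n$, $$N_{r,n}=A_{r-1,n}.$$ -/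

import Mathlib

/-- The cyclic part of a set `F` in a matroid `M`: the union of all circuits contained in `F`. -/
def cyclicPart {α : Type*} (M : Matroid α) (F : Set α) : Set α :=
  ⋃₀ {C | M.IsCircuit C ∧ C ⊆ F}

/-- A cyclic flat: a flat which equals its cyclic part. -/
def IsCyclicFlat {α : Type*} (M : Matroid α) (F : Set α) : Prop :=
  M.IsFlat F ∧ F = cyclicPart M F

/-- A matroid is nested if its cyclic flats form a chain under inclusion. -/
def IsNestedMatroid {α : Type*} (M : Matroid α) : Prop :=
  IsChain (· ⊆ ·) {F : Set α | IsCyclicFlat M F}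

/-- The set of loopfree nested matroids of rank `r` whose ground set is all of `Fin n`.
Matroids are counted as labeled objects: two of them are identified only if they are equal. -/
def nestedMatroids (r n : ℕ) : Set (Matroid (Fin n)) :=
  {M | M.E = Set.univ ∧ M.Loopless ∧ M.eRank = (r : ℕ∞) ∧ IsNestedMatroid M}

/-- The number `N_{r,n}` of loopfree nested matroids of rank `r` on `n` labeled elements. -/
noncomputable def numNested (r n : ℕ) : ℕ :=
  (nestedMatroids r n).ncard

/-- The ascents of a permutation of `n` linearly ordered elements: the positions `i`, other than
the last one, at which the value at `i` is smaller than the value at the next position. -/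
def ascents {n : ℕ} (σ : Equiv.Perm (Fin n)) : Finset (Fin n) :=
  Finset.univ.filter fun i => ∃ h : (i : ℕ) + 1 < n, σ i < σ ⟨(i : ℕ) + 1, h⟩

/-- The Eulerian number `A_{r,n}`: the number of permutations of `n` elements with exactly
`r` ascents. -/
def eulerianNumber (r n : ℕ) : ℕ :=
  (Finset.univ.filter fun σ : Equiv.Perm (Fin n) => (ascents σ).card = r).card

section InsertMax

/-- The permutation of `Fin (n + 1)` whose one-line notation arises from that of `τ` by inserting
the new maximal value at position `j`. -/
def insertMax {n : ℕ} (j : Fin (n + 1)) (τ : Equiv.Perm (Fin n)) : Equiv.Perm (Fin (n + 1)) :=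
  (finSuccEquiv' j).trans ((Equiv.optionCongr τ).trans finSuccEquivLast.symm)

theorem insertMax_self {n : ℕ} (j : Fin (n + 1)) (τ : Equiv.Perm (Fin n)) :
    insertMax j τ j = Fin.last n := by
  simp [insertMax]

theorem insertMax_succAbove {n : ℕ} (j : Fin (n + 1)) (τ : Equiv.Perm (Fin n)) (k : Fin n) :
    insertMax j τ (j.succAbove k) = (τ k).castSucc := by
  simp [insertMax]

theorem insertMax_bijective (n : ℕ) :
    Function.Bijective fun p : Fin (n + 1) × Equiv.Perm (Fin n) => insertMax p.1 p.2 := by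
  rw [Fintype.bijective_iff_injective_and_card]
  refine ⟨?_, by simp [Fintype.card_perm, Nat.factorial_succ]⟩
  rintro ⟨i, σ⟩ ⟨j, τ⟩ h
  dsimp only at h
  obtain rfl : i = j := by
    apply (insertMax j τ).injective
    rw [← h, insertMax_self, h, insertMax_self]
  congr 1
  ext k
  have := insertMax_succAbove i σ k
  rw [h, insertMax_succAbove] at this
  exact congrArg Fin.val (Fin.castSucc_injective _ this).symm

theorem mem_ascents {n : ℕ} {σ : Equiv.Perm (Fin n)} {i : Fin n} :
    i ∈ ascents σ ↔ ∃ h : (i : ℕ) + 1 < n, σ i < σ ⟨(i : ℕ) + 1, h⟩ := by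
  simp [ascents]

theorem insertMax_notMem_ascents {n : ℕ} (j : Fin (n + 1)) (τ : Equiv.Perm (Fin n)) :
    j ∉ ascents (insertMax j τ) := by
  rw [mem_ascents]
  rintro ⟨h, hlt⟩
  rw [insertMax_self] at hlt
  exact absurd hlt (Fin.le_last _).not_gt

theorem succAbove_mem_ascents_insertMax {n : ℕ} (j : Fin (n + 1)) (τ : Equiv.Perm (Fin n))
    (k : Fin n) :
    j.succAbove k ∈ ascents (insertMax j τ) ↔ (k : ℕ) + 1 = j ∨ k ∈ ascents τ := by
  rw [mem_ascents, mem_ascents, insertMax_succAbove]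
  rcases lt_trichotomy ((k : ℕ) + 1) j with hk | hk | hk
  · have hk' : (k : ℕ) + 1 < n := by omega
    have e1 : ((j.succAbove k : Fin (n + 1)) : ℕ) = k := by
      rw [Fin.succAbove_of_castSucc_lt _ _ (by rw [Fin.lt_def]; simp; omega)]; simp
    have e2 : ∀ h, (⟨(j.succAbove k : ℕ) + 1, h⟩ : Fin (n + 1)) = j.succAbove ⟨k + 1, hk'⟩ := by
      intro h
      ext
      rw [Fin.succAbove_of_castSucc_lt j ⟨k + 1, hk'⟩ (by rw [Fin.lt_def]; simp; omega)]
      simp [e1]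
    simp only [e2, insertMax_succAbove, Fin.castSucc_lt_castSucc_iff]
    constructor
    · rintro ⟨_, h⟩; exact Or.inr ⟨hk', h⟩
    · rintro (h | ⟨_, h⟩)
      · omega
      · exact ⟨by omega, h⟩
  · have e1 : ((j.succAbove k : Fin (n + 1)) : ℕ) = k := by
      rw [Fin.succAbove_of_castSucc_lt _ _ (by rw [Fin.lt_def]; simp; omega)]; simp
    have e2 : ∀ h, (⟨(j.succAbove k : ℕ) + 1, h⟩ : Fin (n + 1)) = j := by
      intro h; ext; simp [e1, hk]
    simp only [e2, insertMax_self, Fin.castSucc_lt_last, hk, true_or, iff_true]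
    exact ⟨by omega, trivial⟩
  · have e1 : ((j.succAbove k : Fin (n + 1)) : ℕ) = k + 1 := by
      rw [Fin.succAbove_of_le_castSucc _ _ (by rw [Fin.le_def]; simp; omega)]; simp
    have e2 : ∀ h h', (⟨(j.succAbove k : ℕ) + 1, h⟩ : Fin (n + 1)) =
        j.succAbove ⟨k + 1, h'⟩ := by
      intro h h'
      ext
      rw [Fin.succAbove_of_le_castSucc j ⟨k + 1, h'⟩ (by rw [Fin.le_def]; simp; omega)]
      simp [e1]
    constructor
    · rintro ⟨h, hlt⟩
      have h' : (k : ℕ) + 1 < n := by omega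
      rw [e2 h h', insertMax_succAbove, Fin.castSucc_lt_castSucc_iff] at hlt
      exact Or.inr ⟨h', hlt⟩
    · rintro (h | ⟨h, hlt⟩)
      · omega
      · refine ⟨by omega, ?_⟩
        rwa [e2 _ h, insertMax_succAbove, Fin.castSucc_lt_castSucc_iff]

theorem card_ascents_insertMax {n : ℕ} (j : Fin (n + 1)) (τ : Equiv.Perm (Fin n)) :
    (ascents (insertMax j τ)).card =
      (Finset.univ.filter fun k : Fin n => (k : ℕ) + 1 = j ∨ k ∈ ascents τ).card := by
  rw [← Finset.card_map j.succAboveEmb]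
  congr 1
  ext i
  simp only [Finset.mem_map, Finset.mem_filter, Finset.mem_univ, true_and, Fin.coe_succAboveEmb]
  constructor
  · intro hi
    obtain rfl | ⟨k, rfl⟩ := Fin.eq_self_or_eq_succAbove j i
    · exact absurd hi (insertMax_notMem_ascents _ _)
    · exact ⟨k, (succAbove_mem_ascents_insertMax _ _ _).1 hi, rfl⟩
  · rintro ⟨k, hk, rfl⟩
    exact (succAbove_mem_ascents_insertMax _ _ _).2 hk

theorem card_ascents_insertMax_zero {n : ℕ} (τ : Equiv.Perm (Fin n)) :
    (ascents (insertMax 0 τ)).card = (ascents τ).card := by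
  rw [card_ascents_insertMax]
  congr 1
  ext k
  simp

theorem card_ascents_insertMax_succ {n : ℕ} (i : Fin n) (τ : Equiv.Perm (Fin n)) :
    (ascents (insertMax i.succ τ)).card = (insert i (ascents τ)).card := by
  rw [card_ascents_insertMax]
  congr 1
  ext k
  simp [Fin.ext_iff]

open PowerSeries

/-- The Eulerian polynomial, as a power series: each permutation contributes `X ^ (asc + 1)`. -/
noncomputable def eulerianSeries (n : ℕ) : PowerSeries ℚ :=
  ∑ σ : Equiv.Perm (Fin n), X ^ ((ascents σ).card + 1)

theorem coeff_eulerianSeries (n k : ℕ) :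
    coeff (k + 1) (eulerianSeries n) = eulerianNumber k n := by
  simp [eulerianSeries, eulerianNumber, coeff_X_pow, eq_comm]

theorem sum_insertMax {n : ℕ} (τ : Equiv.Perm (Fin n)) :
    ∑ j : Fin (n + 1), (X : PowerSeries ℚ) ^ ((ascents (insertMax j τ)).card + 1) =
      ((n + 1 : ℕ) : PowerSeries ℚ) * X * X ^ ((ascents τ).card + 1) +
        X * (1 - X) * derivative ℚ (X ^ ((ascents τ).card + 1)) := by
  rw [Fin.sum_univ_succ, card_ascents_insertMax_zero]
  simp only [card_ascents_insertMax_succ]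
  rw [← Finset.sum_add_sum_compl (ascents τ)]
  rw [Finset.sum_congr rfl fun i (hi : i ∈ ascents τ) => by rw [Finset.insert_eq_of_mem hi],
    Finset.sum_congr rfl fun i (hi : i ∈ (ascents τ)ᶜ) => by
      rw [Finset.card_insert_of_notMem (Finset.mem_compl.1 hi)]]
  have hc : (((ascents τ)ᶜ.card : ℕ) : PowerSeries ℚ) = n - (ascents τ).card := by
    rw [eq_sub_iff_add_eq]
    have := Finset.card_add_card_compl (ascents τ)
    rw [Fintype.card_fin] at this
    rw [add_comm]
    exact_mod_cast congrArg (Nat.cast (R := PowerSeries ℚ)) this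
  simp only [Finset.sum_const, nsmul_eq_mul, hc, Derivation.leibniz_pow, derivative_X,
    smul_eq_mul, Nat.add_sub_cancel]
  push_cast
  ring

theorem eulerianSeries_succ (n : ℕ) :
    eulerianSeries (n + 1) = ((n + 1 : ℕ) : PowerSeries ℚ) * X * eulerianSeries n +
      X * (1 - X) * derivative ℚ (eulerianSeries n) := by
  unfold eulerianSeries
  rw [← Function.Bijective.sum_comp (insertMax_bijective n)
    fun σ => (X : PowerSeries ℚ) ^ ((ascents σ).card + 1), Fintype.sum_prod_type_right]
  simp only [sum_insertMax, Finset.sum_add_distrib, Finset.mul_sum, map_sum]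

end InsertMax

section Series

open PowerSeries

/-- The power series `∑ m ^ n X ^ m`. -/
noncomputable def powSeries (n : ℕ) : PowerSeries ℚ := PowerSeries.mk fun m => (m : ℚ) ^ n

theorem powSeries_succ (n : ℕ) : powSeries (n + 1) = X * derivative ℚ (powSeries n) := by
  ext m
  cases m with
  | zero => simp [powSeries]
  | succ m => rw [coeff_succ_X_mul, coeff_derivative]; simp [powSeries]; ring

theorem one_sub_X_mul_powSeries_zero : (1 - X) * powSeries 0 = 1 := by
  have := mk_one_mul_one_sub_eq_one ℚ
  rw [mul_comm]
  convert this using 2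
  ext; simp [powSeries]

theorem eulerianSeries_eq (n : ℕ) :
    eulerianSeries (n + 1) = (1 - X) ^ (n + 2) * powSeries (n + 1) := by
  induction n with
  | zero =>
    rw [eulerianSeries_succ, powSeries_succ]
    have h := congrArg (derivative ℚ) one_sub_X_mul_powSeries_zero
    simp only [Derivation.leibniz, map_sub, derivative_X, smul_eq_mul] at h
    have h0 : eulerianSeries 0 = X := by simp [eulerianSeries, ascents]
    have h1 := one_sub_X_mul_powSeries_zero
    rw [h0, derivative_X]
    simp only [Derivation.map_one_eq_zero] at h
    push_cast
    linear_combination (-X * (1 - X)) * h - X * h1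
  | succ n ih =>
    rw [eulerianSeries_succ, ih, powSeries_succ (n + 1)]
    simp only [Derivation.leibniz, Derivation.leibniz_pow, map_sub, derivative_X, smul_eq_mul,
      Derivation.map_one_eq_zero, nsmul_eq_mul]
    push_cast
    ring

/-- The linear functional sending a polynomial `p` in an auxiliary variable to `∑ p(m) X ^ m`. -/
noncomputable def evalSeries : Polynomial (PowerSeries ℚ) →ₗ[PowerSeries ℚ] PowerSeries ℚ :=
  Polynomial.lsum fun n => LinearMap.toSpanSingleton _ _ (powSeries n)

theorem evalSeries_pow (n : ℕ) : evalSeries (Polynomial.X ^ n) = powSeries n := by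
  simp [evalSeries, Polynomial.lsum_apply, Polynomial.X_pow_eq_monomial,
    Polynomial.sum_monomial_index]

theorem evalSeries_C_mul (a : PowerSeries ℚ) (p : Polynomial (PowerSeries ℚ)) :
    evalSeries (Polynomial.C a * p) = a * evalSeries p := by
  rw [← Polynomial.smul_eq_C_mul, map_smul, smul_eq_mul]

theorem evalSeries_sub_shift (p : Polynomial (PowerSeries ℚ)) :
    evalSeries p - X * evalSeries (p.comp (Polynomial.X + 1)) = p.eval 0 := by
  induction p using Polynomial.induction_on' with
  | add p q hp hq =>
    simp only [map_add, Polynomial.add_comp, Polynomial.eval_add, ← hp, ← hq]; ring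
  | monomial n a =>
    rw [← Polynomial.C_mul_X_pow_eq_monomial, evalSeries_C_mul, Polynomial.mul_comp,
      Polynomial.C_comp, evalSeries_C_mul, Polynomial.pow_comp, Polynomial.X_comp, add_pow,
      Polynomial.eval_mul, Polynomial.eval_C, Polynomial.eval_pow, Polynomial.eval_X, evalSeries_pow]
    have : powSeries n - X * evalSeries (∑ m ∈ Finset.range (n + 1),
        Polynomial.X ^ m * 1 ^ (n - m) * ((n.choose m : ℕ) : Polynomial (PowerSeries ℚ))) =
        (0 : PowerSeries ℚ) ^ n := by
      have h : evalSeries (∑ m ∈ Finset.range (n + 1),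
          Polynomial.X ^ m * 1 ^ (n - m) * ((n.choose m : ℕ) : Polynomial (PowerSeries ℚ))) =
          PowerSeries.mk fun m => ((m : ℚ) + 1) ^ n := by
        rw [map_sum]
        ext m
        rw [coeff_mk, add_pow, map_sum]
        refine Finset.sum_congr rfl fun k _ => ?_
        rw [one_pow, mul_one, mul_comm, ← Polynomial.C_eq_natCast, evalSeries_C_mul,
          evalSeries_pow, mul_comm, ← map_natCast (C (R := ℚ)), coeff_mul_C]
        simp [powSeries]
      rw [h]
      ext m
      cases m with
      | zero => cases n <;> simp [powSeries]
      | succ m =>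
        rw [map_sub, coeff_succ_X_mul]
        cases n <;> simp [powSeries, coeff_one]
    rw [← this]; ring

/-- The generating series, by rank, of the flags whose top set has `n` elements. -/
noncomputable def flagSeries (n : ℕ) : PowerSeries ℚ :=
  (1 - X) * evalSeries
    ((Polynomial.C (1 - X) * Polynomial.X + Polynomial.C (-X)) ^ n)

theorem sum_choose_mul_flagSeries (a : PowerSeries ℚ) (n : ℕ) :
    ∑ m ∈ Finset.range (n + 1), (n.choose m : PowerSeries ℚ) * (a ^ (n - m) * flagSeries m) =
      (1 - X) * evalSeries
        ((Polynomial.C (1 - X) * Polynomial.X + Polynomial.C (a - X)) ^ n) := by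
  have : (Polynomial.C (1 - X) * Polynomial.X + Polynomial.C (a - X) :
      Polynomial (PowerSeries ℚ)) = (Polynomial.C (1 - X) * Polynomial.X + Polynomial.C (-X)) +
      Polynomial.C a := by rw [sub_eq_neg_add a X, Polynomial.C_add]; ring
  rw [this, add_pow, map_sum, Finset.mul_sum]
  refine Finset.sum_congr rfl fun m _ => ?_
  rw [show ∀ p : Polynomial (PowerSeries ℚ), p * Polynomial.C a ^ (n - m) * (n.choose m : ℕ) =
    Polynomial.C (a ^ (n - m) * (n.choose m : ℕ)) * p from fun p => by
      rw [Polynomial.C_mul, Polynomial.C_pow, Polynomial.C_eq_natCast]; ring, evalSeries_C_mul,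
    flagSeries]
  ring

theorem sum_choose_mul_X_pow_mul_flagSeries (n : ℕ) :
    ∑ m ∈ Finset.range (n + 1), (n.choose m : PowerSeries ℚ) * (X ^ (n - m) * flagSeries m) =
      (1 - X) ^ (n + 1) * powSeries n := by
  rw [sum_choose_mul_flagSeries, sub_self, Polynomial.C_0, add_zero, mul_pow, ← Polynomial.C_pow,
    evalSeries_C_mul, evalSeries_pow]
  ring

theorem sum_choose_mul_sub_mul_flagSeries (n : ℕ) :
    ∑ m ∈ Finset.range (n + 1),
      (n.choose m : PowerSeries ℚ) * ((X ^ (n - m) - X) * flagSeries m) = (1 - X) * 0 ^ n := by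
  have h1 := sum_choose_mul_X_pow_mul_flagSeries n
  have h2 := sum_choose_mul_flagSeries 1 n
  have h3 := evalSeries_sub_shift ((Polynomial.C (1 - X) * Polynomial.X) ^ n)
  have h4 : ((Polynomial.C (1 - X) * Polynomial.X) ^ n : Polynomial (PowerSeries ℚ)).comp
      (Polynomial.X + 1) = (Polynomial.C (1 - X) * Polynomial.X + Polynomial.C (1 - X)) ^ n := by
    simp [mul_add]
  rw [h4, mul_pow, ← Polynomial.C_pow, evalSeries_C_mul, evalSeries_pow] at h3
  have h5 : Polynomial.eval 0 (Polynomial.C ((1 - X) ^ n) * Polynomial.X ^ n :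
      Polynomial (PowerSeries ℚ)) = 0 ^ n := by
    cases n <;> simp
  rw [h5] at h3
  simp only [one_pow, one_mul] at h2
  simp only [sub_mul, mul_sub, Finset.sum_sub_distrib]
  rw [h1]
  have h6 : ∑ m ∈ Finset.range (n + 1), (n.choose m : PowerSeries ℚ) * (X * flagSeries m) =
      X * ∑ m ∈ Finset.range (n + 1), (n.choose m : PowerSeries ℚ) * flagSeries m := by
    rw [Finset.mul_sum]; exact Finset.sum_congr rfl fun m _ => by ring
  rw [h6, h2, ← h3]
  ring

end Series

section Flags

open PowerSeries

variable {α : Type*}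

/-- The strict order on ranked sets in which both the rank and the nullity increase. -/
def FlagLT (p q : Finset α × ℕ) : Prop :=
  p.1 ⊂ q.1 ∧ p.2 < q.2 ∧ q.2 + p.1.card < p.2 + q.1.card

theorem FlagLT.trans {p q r : Finset α × ℕ} (h : FlagLT p q) (h' : FlagLT q r) : FlagLT p r :=
  ⟨h.1.trans h'.1, h.2.1.trans h'.2.1, by have := h.2.2; have := h'.2.2; omega⟩

theorem FlagLT.ne {p q : Finset α × ℕ} (h : FlagLT p q) : p ≠ q := by
  rintro rfl
  exact h.2.1.false

theorem FlagLT.asymm {p q : Finset α × ℕ} (h : FlagLT p q) : ¬ FlagLT q p :=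
  fun h' => (h.trans h').ne rfl

/-- A flag of ranked sets: a chain for `FlagLT` starting at the empty set in rank zero. -/
structure IsFlag (D : Finset (Finset α × ℕ)) : Prop where
  bot_mem : (∅, 0) ∈ D
  lt_or_lt : ∀ p ∈ D, ∀ q ∈ D, p ≠ q → FlagLT p q ∨ FlagLT q p

/-- The element `p` is the largest one of `D`. -/
def IsFlagTop (D : Finset (Finset α × ℕ)) (p : Finset α × ℕ) : Prop :=
  p ∈ D ∧ ∀ q ∈ D, q ≠ p → FlagLT q p

theorem IsFlagTop.unique {D : Finset (Finset α × ℕ)} {p q : Finset α × ℕ} (hp : IsFlagTop D p)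
    (hq : IsFlagTop D q) : p = q := by
  by_contra h
  exact (hp.2 q hq.1 (Ne.symm h)).asymm (hq.2 p hp.1 h)

theorem IsFlag.eq_bot_or_flagLT (hD : IsFlag D) {p : Finset α × ℕ} (hp : p ∈ D) :
    p = (∅, 0) ∨ FlagLT (∅, 0) p := by
  by_cases h : p = (∅, 0)
  · exact Or.inl h
  · exact Or.inr ((hD.lt_or_lt p hp _ hD.bot_mem h).resolve_left fun h' =>
      Nat.not_lt_zero _ h'.2.1)

theorem IsFlag.exists_isFlagTop_filter {D : Finset (Finset α × ℕ)} (hD : IsFlag D)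
    (P : Finset α × ℕ → Prop) [DecidablePred P] (h : ∃ p ∈ D, P p) :
    ∃ p, IsFlagTop (D.filter P) p := by
  obtain ⟨p, hp, hmax⟩ := (D.filter P).exists_max_image (fun p => p.2)
    (by obtain ⟨p, hp, hp'⟩ := h; exact ⟨p, Finset.mem_filter.2 ⟨hp, hp'⟩⟩)
  refine ⟨p, hp, fun q hq hqp => ?_⟩
  rcases hD.lt_or_lt q (Finset.mem_filter.1 hq).1 p (Finset.mem_filter.1 hp).1 hqp with h | h
  · exact h
  · exact absurd h.2.1 (hmax q hq).not_gt

theorem IsFlag.exists_isFlagTop {D : Finset (Finset α × ℕ)} (hD : IsFlag D) :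
    ∃ p, IsFlagTop D p := by
  simpa using hD.exists_isFlagTop_filter (fun _ => True) ⟨_, hD.bot_mem, trivial⟩

open Classical in
/-- The flags with largest element `p`. -/
noncomputable def flagsTo (p : Finset α × ℕ) : Finset (Finset (Finset α × ℕ)) :=
  (p.1.powerset ×ˢ Finset.range (p.2 + 1)).powerset.filter fun D => IsFlag D ∧ IsFlagTop D p

theorem mem_flagsTo {p : Finset α × ℕ} {D : Finset (Finset α × ℕ)} :
    D ∈ flagsTo p ↔ IsFlag D ∧ IsFlagTop D p := by
  simp only [flagsTo, Finset.mem_filter, Finset.mem_powerset, and_iff_right_iff_imp]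
  rintro ⟨-, hp, h⟩ q hq
  by_cases hqp : q = p
  · simp [hqp]
  · have := h q hq hqp
    simp only [Finset.mem_product, Finset.mem_powerset, Finset.mem_range]
    exact ⟨this.1.1, this.2.1.trans (Nat.lt_succ_self _)⟩

theorem flagsTo_empty_zero : flagsTo ((∅ : Finset α), 0) = {{(∅, 0)}} := by
  ext D
  rw [mem_flagsTo, Finset.mem_singleton]
  constructor
  · rintro ⟨-, hp, h⟩
    refine Finset.eq_singleton_iff_unique_mem.2 ⟨hp, fun q hq => ?_⟩
    by_contra hne
    exact Nat.not_lt_zero _ (h q hq hne).2.1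
  · rintro rfl
    exact ⟨⟨by simp, by simp⟩, by simp, by simp⟩

theorem flagsTo_empty_of_ne_zero {k : ℕ} (hk : k ≠ 0) : flagsTo ((∅ : Finset α), k) = ∅ := by
  refine Finset.eq_empty_of_forall_notMem fun D hD => ?_
  rw [mem_flagsTo] at hD
  exact Finset.not_ssubset_empty _ (hD.2.2 _ hD.1.bot_mem (by simpa using hk.symm)).1

/-- The generating series, by rank, of the flags whose largest set is `F`. -/
noncomputable def flagSeriesOf (F : Finset α) : PowerSeries ℚ :=
  PowerSeries.mk fun k => ((flagsTo (F, k)).card : ℚ)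

theorem flagSeriesOf_empty : flagSeriesOf (∅ : Finset α) = 1 := by
  ext k
  rw [flagSeriesOf, coeff_mk, coeff_one]
  split_ifs with h
  · rw [h, flagsTo_empty_zero]; simp
  · rw [flagsTo_empty_of_ne_zero h]; simp

variable [DecidableEq α]

theorem insert_mem_flagsTo {p q : Finset α × ℕ} {D : Finset (Finset α × ℕ)} (hqp : FlagLT q p)
    (hD : D ∈ flagsTo q) : p ∉ D ∧ insert p D ∈ flagsTo p := by
  rw [mem_flagsTo] at *
  have hlt : ∀ r ∈ D, FlagLT r p := fun r hr => by
    by_cases h : r = q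
    · rwa [h]
    · exact (hD.2.2 r hr h).trans hqp
  refine ⟨fun hp => (hlt p hp).ne rfl, ⟨Finset.mem_insert_of_mem hD.1.bot_mem, ?_⟩,
    Finset.mem_insert_self _ _, ?_⟩
  · intro a ha b hb hab
    rw [Finset.mem_insert] at ha hb
    rcases ha with rfl | ha <;> rcases hb with rfl | hb
    · exact absurd rfl hab
    · exact Or.inr (hlt b hb)
    · exact Or.inl (hlt a ha)
    · exact hD.1.lt_or_lt a ha b hb hab
  · intro r hr hrp
    exact hlt r (Finset.mem_of_mem_insert_of_ne hr hrp)

theorem exists_erase_mem_flagsTo {p : Finset α × ℕ} (hp : p ≠ (∅, 0))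
    {D : Finset (Finset α × ℕ)} (hD : D ∈ flagsTo p) :
    ∃ q, FlagLT q p ∧ D.erase p ∈ flagsTo q := by
  rw [mem_flagsTo] at hD
  have hE : IsFlag (D.erase p) :=
    ⟨Finset.mem_erase.2 ⟨hp.symm, hD.1.bot_mem⟩, fun a ha b hb =>
      hD.1.lt_or_lt a (Finset.mem_of_mem_erase ha) b (Finset.mem_of_mem_erase hb)⟩
  obtain ⟨q, hq⟩ := hE.exists_isFlagTop
  have := Finset.mem_erase.1 hq.1
  exact ⟨q, hD.2.2 q this.2 this.1, mem_flagsTo.2 ⟨hE, hq⟩⟩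

open Classical in
theorem card_flagsTo {p : Finset α × ℕ} (hp : p ≠ (∅, 0)) :
    (flagsTo p).card =
      ∑ q ∈ (p.1.ssubsets ×ˢ Finset.range p.2).filter (FlagLT · p), (flagsTo q).card := by
  have h : flagsTo p = ((p.1.ssubsets ×ˢ Finset.range p.2).filter (FlagLT · p)).biUnion
      fun q => (flagsTo q).image (insert p) := by
    ext D
    simp only [Finset.mem_biUnion, Finset.mem_image, Finset.mem_filter, Finset.mem_product,
      Finset.mem_ssubsets, Finset.mem_range]
    constructor
    · intro hD
      obtain ⟨q, hq, hE⟩ := exists_erase_mem_flagsTo hp hD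
      exact ⟨q, ⟨⟨hq.1, hq.2.1⟩, hq⟩, _, hE, Finset.insert_erase (mem_flagsTo.1 hD).2.1⟩
    · rintro ⟨q, ⟨-, hq⟩, E, hE, rfl⟩
      exact (insert_mem_flagsTo hq hE).2
  rw [h, Finset.card_biUnion]
  · refine Finset.sum_congr rfl fun q hq => Finset.card_image_of_injOn fun D hD E hE hDE => ?_
    have hq' := (Finset.mem_filter.1 hq).2
    rw [← Finset.erase_insert (insert_mem_flagsTo hq' hD).1,
      ← Finset.erase_insert (insert_mem_flagsTo hq' hE).1]
    exact congrArg (Finset.erase · p) hDE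
  · intro q hq r hr hqr
    rw [Finset.mem_coe, Finset.mem_filter] at hq hr
    refine Finset.disjoint_left.2 fun D hD hD' => hqr ?_
    obtain ⟨E, hE, rfl⟩ := Finset.mem_image.1 hD
    obtain ⟨E', hE', h⟩ := Finset.mem_image.1 hD'
    have : E = E' := by
      rw [← Finset.erase_insert (insert_mem_flagsTo hq.2 hE).1, ← h,
        Finset.erase_insert (insert_mem_flagsTo hr.2 hE').1]
    subst this
    exact (mem_flagsTo.1 hE).2.unique (mem_flagsTo.1 hE').2

/-- The series `X + ⋯ + X ^ (s - 1)`. -/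
noncomputable def stepSeries (s : ℕ) : PowerSeries ℚ :=
  PowerSeries.mk fun d => if 0 < d ∧ d < s then 1 else 0

theorem one_sub_X_mul_stepSeries {s : ℕ} (hs : 0 < s) :
    (1 - X) * stepSeries s = X - X ^ s := by
  ext k
  rw [sub_mul, one_mul]
  cases k with
  | zero => simp [stepSeries, hs.ne']
  | succ k =>
    rw [map_sub, coeff_succ_X_mul, map_sub, coeff_X, coeff_X_pow]
    simp only [stepSeries, coeff_mk]
    split_ifs <;> first | omega | norm_num

theorem flagSeriesOf_eq_sum {F : Finset α} (hF : F.Nonempty) :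
    flagSeriesOf F = ∑ G ∈ F.ssubsets, stepSeries (F.card - G.card) * flagSeriesOf G := by
  classical
  ext k
  rw [flagSeriesOf, coeff_mk, card_flagsTo (by simp [hF.ne_empty]), Finset.sum_filter,
    Finset.sum_product, map_sum]
  push_cast
  refine Finset.sum_congr rfl fun G hG => ?_
  rw [mul_comm, coeff_mul, Finset.Nat.sum_antidiagonal_eq_sum_range_succ_mk,
    Finset.sum_range_succ]
  simp only [flagSeriesOf, stepSeries, coeff_mk, Nat.sub_self, lt_irrefl, false_and, if_false,
    mul_zero, add_zero]
  refine Finset.sum_congr rfl fun j hj => ?_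
  rw [Finset.mem_range] at hj
  rw [Finset.mem_ssubsets] at hG
  have hcard := Finset.card_lt_card hG
  rw [mul_ite, mul_one, mul_zero]
  refine if_congr ?_ rfl rfl
  constructor
  · rintro ⟨-, -, h⟩
    dsimp only at h
    omega
  · rintro ⟨-, h⟩
    exact ⟨hG, hj, by dsimp only; omega⟩

theorem one_sub_X_ne_zero : (1 - X : PowerSeries ℚ) ≠ 0 := by
  intro h
  have := congrArg (coeff 0) h
  simp at this

theorem flagSeriesOf_eq (F : Finset α) : flagSeriesOf F = flagSeries F.card := by
  induction F using Finset.strongInduction with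
  | H F ih =>
  have h := sum_choose_mul_sub_mul_flagSeries F.card
  have hsum := Finset.sum_powerset_apply_card
    (fun m => (X ^ (F.card - m) - X) * flagSeries m) (x := F)
  simp only [nsmul_eq_mul] at hsum
  rw [← hsum, ← Finset.add_sum_erase _ _ (Finset.mem_powerset_self F), Nat.sub_self, pow_zero] at h
  apply mul_left_cancel₀ one_sub_X_ne_zero
  rcases F.eq_empty_or_nonempty with rfl | hF
  · simp [flagSeriesOf_empty] at h ⊢
    exact h.symm
  · rw [zero_pow hF.card_ne_zero, mul_zero] at h
    rw [eq_neg_of_add_eq_zero_left h, flagSeriesOf_eq_sum hF, Finset.mul_sum,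
      ← Finset.sum_neg_distrib]
    refine Finset.sum_congr rfl fun G hG => ?_
    replace hG : G ⊂ F := Finset.mem_ssubsets.1 hG
    have := Finset.card_lt_card hG
    rw [← mul_assoc, one_sub_X_mul_stepSeries (by omega), ih G hG]
    ring

theorem sum_X_pow_mul_flagSeriesOf (n : ℕ) :
    ∑ F : Finset (Fin (n + 1)), X ^ (n + 1 - F.card) * flagSeriesOf F =
      eulerianSeries (n + 1) := by
  have hsum := Finset.sum_powerset_apply_card
    (fun m => X ^ (n + 1 - m) * flagSeries m) (x := (Finset.univ : Finset (Fin (n + 1))))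
  simp only [nsmul_eq_mul, Finset.powerset_univ, Finset.card_univ, Fintype.card_fin] at hsum
  rw [eulerianSeries_eq, ← sum_choose_mul_X_pow_mul_flagSeries, ← hsum]
  exact Finset.sum_congr rfl fun F _ => by rw [flagSeriesOf_eq]

end Flags

section CyclicFlats

variable {α : Type*} {M : Matroid α}

theorem isCyclicFlat_iff {F : Set α} : IsCyclicFlat M F ↔
    M.IsFlat F ∧ ∀ e ∈ F, ∃ C, M.IsCircuit C ∧ C ⊆ F ∧ e ∈ C := by
  refine and_congr_right fun _ => ⟨fun h e he => ?_, fun h => ?_⟩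
  · rw [h] at he
    obtain ⟨C, hC, heC⟩ := he
    exact ⟨C, hC.1, hC.2, heC⟩
  · refine Set.Subset.antisymm (fun e he => ?_) (Set.sUnion_subset fun C hC => hC.2)
    obtain ⟨C, hC, hCF, heC⟩ := h e he
    exact ⟨C, ⟨hC, hCF⟩, heC⟩

theorem isCyclicFlat_closure {C : Set α} (hC : M.IsCircuit C) :
    IsCyclicFlat M (M.closure C) := by
  have hCcl := M.subset_closure C hC.subset_ground
  refine isCyclicFlat_iff.2 ⟨M.isFlat_closure C, fun e he => ?_⟩
  by_cases heC : e ∈ C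
  · exact ⟨C, hC, hCcl, heC⟩
  · obtain ⟨C', hC', hC'c, heC'⟩ := Matroid.exists_isCircuit_of_mem_closure he heC
    exact ⟨C', hC'c, hC'.trans (Set.insert_subset he hCcl), heC'⟩

theorem isCyclicFlat_empty (h : M.Loopless) : IsCyclicFlat M ∅ := by
  refine isCyclicFlat_iff.2 ⟨?_, by simp⟩
  rw [Matroid.isFlat_iff_closure_eq]
  exact h.loops_eq_empty

theorem eRank_eq_of_forall_subset {T : Set α} (hTE : T ⊆ M.E)
    (h : ∀ F, IsCyclicFlat M F → F ⊆ T) : M.eRank = M.eRk T + (M.E \ T).encard := by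
  refine le_antisymm ?_ ?_
  · rw [← M.eRk_ground]
    exact (M.eRk_le_eRk_add_eRk_sdiff hTE).trans (add_le_add_right (M.eRk_le_encard _) _)
  · obtain ⟨I, hI⟩ := M.exists_isBasis T
    have hind : M.Indep (I ∪ (M.E \ T)) := by
      rw [Matroid.indep_iff_forall_subset_not_isCircuit
        (Set.union_subset hI.indep.subset_ground Set.sdiff_subset)]
      intro C hCI hC
      have hCT := (M.subset_closure C hC.subset_ground).trans (h _ (isCyclicFlat_closure hC))
      exact hC.not_indep (hI.indep.subset fun x hx =>
        (hCI hx).resolve_right fun hx' => hx'.2 (hCT hx))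
    rw [hI.eRk_eq_encard, ← Set.encard_union_eq (Set.disjoint_sdiff_right.mono_left hI.subset)]
    exact hind.encard_le_eRank

theorem IsCyclicFlat.flagLT {F G : Finset α} {a b : ℕ} (hF : IsCyclicFlat M F)
    (hG : IsCyclicFlat M G) (hFG : F ⊂ G) (ha : M.eRk F = a) (hb : M.eRk G = b) :
    FlagLT (F, a) (G, b) := by
  classical
  obtain ⟨e, heG, heF⟩ := Finset.exists_of_ssubset hFG
  have hFG' : (F : Set α) ⊆ G := Finset.coe_subset.2 hFG.1
  refine ⟨hFG, ?_, ?_⟩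
  · have h := Matroid.eRk_insert_eq_add_one (M := M) (e := e) (X := (F : Set α))
      ⟨hG.1.subset_ground heG, by rwa [hF.1.closure]⟩
    have h' := M.eRk_mono (Set.insert_subset (Finset.mem_coe.2 heG) hFG')
    rw [h, ha, hb] at h'
    exact_mod_cast h'
  · obtain ⟨C, hC, hCG, heC⟩ := (isCyclicFlat_iff.1 hG).2 e heG
    have hcl : e ∈ M.closure ((G : Set α) \ {e}) :=
      M.closure_subset_closure (Set.sdiff_subset_sdiff_left hCG)
        (hC.mem_closure_sdiff_singleton_of_mem heC)
    have h1 : M.eRk G = M.eRk ((G : Set α) \ {e}) := by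
      rw [← M.eRk_closure_eq ((G : Set α) \ {e}), ← Set.insert_eq_of_mem hcl,
        M.eRk_insert_closure_eq, Set.insert_sdiff_singleton, Set.insert_eq_of_mem]
      exact heG
    have h2 : (G : Set α) \ {e} = (F : Set α) ∪ (((G.erase e) \ F : Finset α) : Set α) := by
      ext x
      simp only [Set.mem_sdiff, Finset.mem_coe, Set.mem_singleton_iff, Set.mem_union,
        Finset.mem_sdiff, Finset.mem_erase]
      have : x ∈ F → x ∈ G ∧ x ≠ e := fun hx => ⟨hFG.1 hx, by rintro rfl; exact heF hx⟩
      tauto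
    have h3 := M.eRk_union_le_eRk_add_encard F (((G.erase e) \ F : Finset α) : Set α)
    rw [← h2, ← h1, ha, hb, Set.encard_coe_eq_coe_finsetCard] at h3
    have h4 : b ≤ a + ((G.erase e) \ F).card := by exact_mod_cast h3
    rw [Finset.card_sdiff_of_subset
      (fun x hx => Finset.mem_erase.2 ⟨by rintro rfl; exact heF hx, hFG.1 hx⟩),
      Finset.card_erase_of_mem heG] at h4
    have h5 := Finset.card_lt_card hFG
    dsimp only
    omega

variable [Finite α]

theorem indep_iff_encard_inter_le {I : Set α} : M.Indep I ↔
    I ⊆ M.E ∧ ∀ F, IsCyclicFlat M F → (I ∩ F).encard ≤ M.eRk F := by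
  refine ⟨fun h => ⟨h.subset_ground, fun F _ =>
    (h.inter_right F).encard_le_eRk_of_subset Set.inter_subset_right⟩, fun ⟨hE, h⟩ => ?_⟩
  rw [Matroid.indep_iff_forall_subset_not_isCircuit hE]
  intro C hCI hC
  have h1 := h _ (isCyclicFlat_closure hC)
  rw [Matroid.eRk_closure_eq] at h1
  have h2 : C.encard ≤ M.eRk C := (Set.encard_le_encard
    (Set.subset_inter hCI (M.subset_closure C hC.subset_ground))).trans h1
  rw [← hC.eRk_add_one_eq] at h2
  have h3 : M.eRk C ≠ ⊤ := ((M.eRk_le_encard C).trans_lt (Set.toFinite C).encard_lt_top).ne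
  exact absurd (ENat.add_one_le_iff h3 |>.1 h2) (lt_irrefl _)

end CyclicFlats

section FlagOfMatroid

variable {α : Type*} [Fintype α] {M : Matroid α}

open Classical in
/-- The cyclic flats of a matroid together with their ranks. -/
noncomputable def flagOf (M : Matroid α) : Finset (Finset α × ℕ) :=
  (Finset.univ.filter fun F : Finset α => IsCyclicFlat M F).image
    fun F => (F, (M.eRk F).toNat)

theorem coe_toNat_eRk (M : Matroid α) (F : Set α) : ((M.eRk F).toNat : ℕ∞) = M.eRk F :=
  ENat.natCast_toNat ((M.eRk_le_encard F).trans_lt (Set.toFinite F).encard_lt_top).ne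

theorem mem_flagOf {p : Finset α × ℕ} :
    p ∈ flagOf M ↔ IsCyclicFlat M p.1 ∧ M.eRk p.1 = p.2 := by
  simp only [flagOf, Finset.mem_image, Finset.mem_filter, Finset.mem_univ, true_and]
  constructor
  · rintro ⟨F, hF, rfl⟩
    exact ⟨hF, (coe_toNat_eRk M _).symm⟩
  · rintro ⟨h, h'⟩
    exact ⟨p.1, h, by rw [h', ENat.toNat_natCast]⟩

theorem isFlag_flagOf (hM : M.Loopless) (hn : IsNestedMatroid M) : IsFlag (flagOf M) := by
  refine ⟨mem_flagOf.2 ⟨by simpa using isCyclicFlat_empty hM, by simp⟩, fun p hp q hq hpq => ?_⟩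
  rw [mem_flagOf] at hp hq
  have hne : p.1 ≠ q.1 := fun h => hpq (Prod.ext h (by
    have := hp.2
    rw [h, hq.2] at this
    exact_mod_cast this.symm))
  rcases hn hp.1 hq.1 (by simpa using hne) with h | h
  · exact Or.inl (hp.1.flagLT hq.1 (Finset.ssubset_iff_subset_ne.2
      ⟨Finset.coe_subset.1 h, hne⟩) hp.2 hq.2)
  · exact Or.inr (hq.1.flagLT hp.1 (Finset.ssubset_iff_subset_ne.2
      ⟨Finset.coe_subset.1 h, hne.symm⟩) hq.2 hp.2)

theorem eq_of_flagOf_eq {N : Matroid α} (hE : M.E = N.E) (h : flagOf M = flagOf N) : M = N := by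
  have key : ∀ {M N : Matroid α}, M.E = N.E → flagOf M = flagOf N → ∀ I, M.Indep I → N.Indep I := by
    intro M N hE h I hI
    rw [indep_iff_encard_inter_le] at hI ⊢
    refine ⟨hE ▸ hI.1, fun F hF => ?_⟩
    obtain ⟨F, rfl⟩ := (Set.toFinite F).exists_finset_coe
    have hmem : (F, (N.eRk F).toNat) ∈ flagOf M := by
      rw [h]; exact mem_flagOf.2 ⟨hF, (coe_toNat_eRk N _).symm⟩
    rw [mem_flagOf, coe_toNat_eRk] at hmem
    exact hmem.2 ▸ hI.2 F hmem.1
  exact Matroid.ext_indep hE fun I _ => ⟨key hE h I, key hE.symm h.symm I⟩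

theorem eRank_of_isFlagTop {p : Finset α × ℕ} (hE : M.E = Set.univ) (hp : IsFlagTop (flagOf M) p) :
    M.eRank = (p.2 + (Fintype.card α - p.1.card) : ℕ) := by
  classical
  rw [eRank_eq_of_forall_subset (T := (p.1 : Set α)) (hE ▸ Set.subset_univ _), (mem_flagOf.1 hp.1).2,
    hE, ← Set.compl_eq_univ_sdiff, ← Finset.coe_compl, Set.encard_coe_eq_coe_finsetCard,
    Finset.card_compl]
  · norm_cast
  · intro F hF
    obtain ⟨F, rfl⟩ := (Set.toFinite F).exists_finset_coe
    have hmem : (F, (M.eRk F).toNat) ∈ flagOf M := mem_flagOf.2 ⟨hF, (coe_toNat_eRk M _).symm⟩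
    by_cases h : (F, (M.eRk F).toNat) = p
    · rw [← h]
    · exact Finset.coe_subset.2 (hp.2 _ hmem h).1.1

end FlagOfMatroid

section MatroidOfFlag

variable {α : Type*} [Fintype α] {D : Finset (Finset α × ℕ)}

/-- The sets meeting each member of a flag in at most its rank many elements are the independent
sets of a matroid. -/
noncomputable def IsFlag.toMatroid (hD : IsFlag D) : Matroid α :=
  (IndepMatroid.ofFinite Set.finite_univ (fun I => ∀ p ∈ D, (I ∩ (p.1 : Set α)).ncard ≤ p.2)
    (by simp)
    (fun I J hJ hIJ p hp => (Set.ncard_le_ncard (Set.inter_subset_inter_left _ hIJ)).trans (hJ p hp))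
    (by
      classical
      intro I J hI hJ hIJ
      obtain ⟨i, hi, hmax⟩ := hD.exists_isFlagTop_filter
        (fun p => (I ∩ (p.1 : Set α)).ncard = p.2) ⟨_, hD.bot_mem, by simp⟩
      rw [Finset.mem_filter] at hi
      have h1 := Set.ncard_inter_add_ncard_sdiff_eq_ncard I (i.1 : Set α)
      have h2 := Set.ncard_inter_add_ncard_sdiff_eq_ncard J (i.1 : Set α)
      have h3 := hJ i hi.1
      obtain ⟨e, heJ, heI⟩ := Set.exists_mem_notMem_of_ncard_lt_ncard
        (s := I \ (i.1 : Set α)) (t := J \ (i.1 : Set α)) (by omega)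
      refine ⟨e, heJ.1, fun h => heI ⟨h, heJ.2⟩, fun p hp => ?_⟩
      by_cases hep : e ∈ (p.1 : Set α)
      · have hne : (I ∩ (p.1 : Set α)).ncard ≠ p.2 := by
          intro h
          by_cases hpi : p = i
          · exact heJ.2 (hpi ▸ hep)
          · exact heJ.2 ((hmax p (Finset.mem_filter.2 ⟨hp, h⟩) hpi).1.1 hep)
        rw [Set.insert_inter_of_mem hep]
        exact (Set.ncard_insert_le _ _).trans (lt_of_le_of_ne (hI p hp) hne)
      · rw [Set.insert_inter_of_notMem hep]
        exact hI p hp)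
    (fun I _ => Set.subset_univ I)).matroid

theorem IsFlag.toMatroid_E (hD : IsFlag D) : hD.toMatroid.E = Set.univ := rfl

theorem IsFlag.toMatroid_indep (hD : IsFlag D) {I : Set α} :
    hD.toMatroid.Indep I ↔ ∀ p ∈ D, (I ∩ (p.1 : Set α)).ncard ≤ p.2 := Iff.rfl

theorem IsFlag.toMatroid_loopless (hD : IsFlag D) : hD.toMatroid.Loopless := by
  rw [Matroid.loopless_iff_forall_isNonloop]
  intro e _
  rw [← Matroid.indep_singleton, hD.toMatroid_indep]
  intro p hp
  rcases hD.eq_bot_or_flagLT hp with rfl | h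
  · simp
  · have h1 := Set.ncard_le_ncard (Set.inter_subset_left (s := {e}) (t := (p.1 : Set α)))
    rw [Set.ncard_singleton] at h1
    have := h.2.1
    dsimp only at this
    omega

theorem IsFlag.exists_indep_notMem (hD : IsFlag D) {p : Finset α × ℕ} (hp : p ∈ D) (e : α) :
    ∃ I : Set α, I ⊆ p.1 ∧ e ∉ I ∧ I.ncard = p.2 ∧ hD.toMatroid.Indep I := by
  classical
  obtain ⟨k, hk⟩ : ∃ k, p.2 = k := ⟨_, rfl⟩
  induction k using Nat.strong_induction_on generalizing p with
  | _ k ih =>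
  rcases hD.eq_bot_or_flagLT hp with rfl | h
  · exact ⟨∅, by simp, by simp, by simp, hD.toMatroid.empty_indep⟩
  obtain ⟨q, hq, hmax⟩ := hD.exists_isFlagTop_filter (FlagLT · p) ⟨_, hD.bot_mem, h⟩
  rw [Finset.mem_filter] at hq
  obtain ⟨J, hJq, heJ, hJc, hJ⟩ := ih q.2 (hk ▸ hq.2.2.1) hq.1 rfl
  have hcard : p.2 - q.2 ≤ ((p.1 \ q.1).erase e).card := by
    have h1 := Finset.pred_card_le_card_erase (s := p.1 \ q.1) (a := e)
    rw [Finset.card_sdiff_of_subset hq.2.1.1] at h1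
    have h2 := hq.2.2.2
    omega
  obtain ⟨K, hKs, hKc⟩ := Finset.exists_subset_card_eq hcard
  have hK : ∀ x ∈ K, x ≠ e ∧ x ∈ p.1 ∧ x ∉ q.1 := fun x hx => by
    have := hKs hx
    simpa using this
  have hcardI : (J ∪ (K : Set α)).ncard = p.2 := by
    rw [Set.ncard_union_eq, hJc, Set.ncard_coe_finset, hKc]
    · have := hq.2.2.1
      omega
    · exact Set.disjoint_left.2 fun x hx hx' => (hK x hx').2.2 (hJq hx)
  refine ⟨J ∪ K, Set.union_subset (hJq.trans (Finset.coe_subset.2 hq.2.1.1))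
    fun x hx => (hK x hx).2.1, ?_, hcardI, ?_⟩
  · rintro (h' | h')
    · exact heJ h'
    · exact (hK e h').1 rfl
  · rw [hD.toMatroid_indep] at hJ ⊢
    intro r hr
    by_cases hrp : FlagLT r p
    · refine (Set.ncard_le_ncard ?_).trans (hJ r hr)
      have hrq : r.1 ⊆ q.1 := by
        by_cases hrq : r = q
        · rw [hrq]
        · exact (hmax r (Finset.mem_filter.2 ⟨hr, hrp⟩) hrq).1.1
      rintro x ⟨hx | hx, hxr⟩
      · exact ⟨hx, hxr⟩
      · exact absurd (hrq hxr) (hK x hx).2.2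
    · refine (Set.ncard_le_ncard Set.inter_subset_left).trans (hcardI.le.trans ?_)
      by_cases hrp' : r = p
      · rw [hrp']
      · exact ((hD.lt_or_lt r hr p hp hrp').resolve_left hrp).2.1.le

theorem IsFlag.exists_indep (hD : IsFlag D) {p : Finset α × ℕ} (hp : p ∈ D) :
    ∃ I : Set α, I ⊆ p.1 ∧ I.ncard = p.2 ∧ hD.toMatroid.Indep I := by
  rcases isEmpty_or_nonempty α with hα | ⟨⟨e⟩⟩
  · refine ⟨∅, by simp, ?_, hD.toMatroid.empty_indep⟩
    rcases hD.eq_bot_or_flagLT hp with rfl | h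
    · simp
    · exact absurd (Finset.eq_empty_of_isEmpty p.1) (Finset.nonempty_iff_ne_empty.1
        ((Finset.empty_ssubset).1 h.1))
  · obtain ⟨I, h1, -, h2⟩ := hD.exists_indep_notMem hp e
    exact ⟨I, h1, h2⟩

theorem IsFlag.toMatroid_eRk (hD : IsFlag D) {p : Finset α × ℕ} (hp : p ∈ D) :
    hD.toMatroid.eRk p.1 = p.2 := by
  refine le_antisymm (Matroid.eRk_le_iff.2 fun I hIp hI => ?_) ?_
  · have := hD.toMatroid_indep.1 hI p hp
    rw [Set.inter_eq_left.2 hIp] at this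
    rw [← (Set.toFinite I).cast_ncard_eq]
    exact_mod_cast this
  · obtain ⟨I, hIp, hIc, hI⟩ := hD.exists_indep hp
    rw [← hIc, (Set.toFinite I).cast_ncard_eq]
    exact hI.encard_le_eRk_of_subset hIp

theorem IsFlag.toMatroid_isFlat (hD : IsFlag D) {p : Finset α × ℕ} (hp : p ∈ D) :
    hD.toMatroid.IsFlat p.1 := by
  rw [Matroid.isFlat_iff_closure_eq]
  refine Set.Subset.antisymm (fun e he => ?_)
    (hD.toMatroid.subset_closure _ (Set.subset_univ _))
  by_contra hep
  obtain ⟨I, hIp, hIc, hI⟩ := hD.exists_indep hp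
  have heI : e ∉ I := fun h => hep (hIp h)
  have hins : hD.toMatroid.Indep (insert e I) := by
    rw [hD.toMatroid_indep] at hI ⊢
    intro r hr
    by_cases her : e ∈ (r.1 : Set α)
    · have hpr : FlagLT p r := by
        refine (hD.lt_or_lt p hp r hr ?_).resolve_right fun h => hep (h.1.1 her)
        rintro rfl
        exact hep her
      refine (Set.ncard_le_ncard Set.inter_subset_left).trans ?_
      rw [Set.ncard_insert_of_notMem heI, hIc]
      exact hpr.2.1
    · rw [Set.insert_inter_of_notMem her]
      exact hI r hr
  have h1 := hins.encard_le_eRk_of_subset (Set.insert_subset_insert (a := e) hIp)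
  rw [← hD.toMatroid.eRk_insert_closure_eq, Set.insert_eq_of_mem he, Matroid.eRk_closure_eq,
    hD.toMatroid_eRk hp, ← (Set.toFinite _).cast_ncard_eq, Set.ncard_insert_of_notMem heI,
    hIc] at h1
  have : p.2 + 1 ≤ p.2 := by exact_mod_cast h1
  omega

theorem IsFlag.toMatroid_isCyclicFlat (hD : IsFlag D) {p : Finset α × ℕ} (hp : p ∈ D) :
    IsCyclicFlat hD.toMatroid p.1 := by
  refine isCyclicFlat_iff.2 ⟨hD.toMatroid_isFlat hp, fun e he => ?_⟩
  obtain ⟨I, hIp, heI, hIc, hI⟩ := hD.exists_indep_notMem hp e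
  have hsub : insert e I ⊆ (p.1 : Set α) := Set.insert_subset he hIp
  have hdep : hD.toMatroid.Dep (insert e I) := by
    refine ⟨fun h => ?_, Set.subset_univ _⟩
    have := hD.toMatroid_indep.1 h p hp
    rw [Set.inter_eq_left.2 hsub, Set.ncard_insert_of_notMem heI, hIc] at this
    omega
  obtain ⟨C, hCI, hC⟩ := hdep.exists_isCircuit_subset
  refine ⟨C, hC, hCI.trans hsub, ?_⟩
  by_contra heC
  exact hC.not_indep (hI.subset ((Set.subset_insert_iff_of_notMem heC).1 hCI))

theorem IsFlag.exists_closure_eq (hD : IsFlag D) {C : Set α} (hC : hD.toMatroid.IsCircuit C) :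
    ∃ p ∈ D, hD.toMatroid.closure C = p.1 := by
  have h := hC.not_indep
  rw [hD.toMatroid_indep] at h
  push Not at h
  obtain ⟨p, hp, hlt⟩ := h
  refine ⟨p, hp, ?_⟩
  have hinter : C ∩ (p.1 : Set α) = C := by
    refine hC.eq_of_not_indep_subset (fun hI => ?_) Set.inter_subset_left
    have := hD.toMatroid_indep.1 hI p hp
    rw [Set.inter_assoc, Set.inter_self] at this
    omega
  rw [hinter] at hlt
  rw [← (hD.toMatroid_isFlat hp).closure]
  refine (hD.toMatroid.isRkFinite_of_finite (Set.toFinite C)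
    ).closure_eq_closure_of_subset_of_eRk_ge_eRk (Set.inter_eq_left.1 hinter) ?_
  rw [hD.toMatroid_eRk hp]
  have h1 := hC.eRk_add_one_eq
  rw [← (Set.toFinite C).cast_ncard_eq, ← coe_toNat_eRk] at h1
  have h2 : (hD.toMatroid.eRk C).toNat + 1 = C.ncard := by exact_mod_cast h1
  rw [← coe_toNat_eRk]
  exact_mod_cast (by omega : p.2 ≤ (hD.toMatroid.eRk C).toNat)

theorem IsFlag.exists_eq_of_isCyclicFlat (hD : IsFlag D) {Z : Set α}
    (hZ : IsCyclicFlat hD.toMatroid Z) : ∃ p ∈ D, (p.1 : Set α) = Z := by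
  classical
  obtain ⟨p, hp, hmax⟩ := hD.exists_isFlagTop_filter (fun p => (p.1 : Set α) ⊆ Z)
    ⟨_, hD.bot_mem, by simp⟩
  rw [Finset.mem_filter] at hp
  refine ⟨p, hp.1, hp.2.antisymm fun e he => ?_⟩
  obtain ⟨C, hC, hCZ, heC⟩ := (isCyclicFlat_iff.1 hZ).2 e he
  obtain ⟨q, hq, hCq⟩ := hD.exists_closure_eq hC
  have heq : e ∈ (q.1 : Set α) :=
    hCq ▸ hD.toMatroid.subset_closure C hC.subset_ground heC
  have hqZ : (q.1 : Set α) ⊆ Z := by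
    rw [← hCq, ← hZ.1.closure]
    exact hD.toMatroid.closure_subset_closure hCZ
  by_cases hqp : q = p
  · rwa [← hqp]
  · exact (hmax q (Finset.mem_filter.2 ⟨hq, hqZ⟩) hqp).1.1 heq

theorem IsFlag.flagOf_toMatroid (hD : IsFlag D) : flagOf hD.toMatroid = D := by
  ext p
  rw [mem_flagOf]
  refine ⟨fun ⟨h, h'⟩ => ?_, fun hp => ⟨hD.toMatroid_isCyclicFlat hp, hD.toMatroid_eRk hp⟩⟩
  obtain ⟨q, hq, hqp⟩ := hD.exists_eq_of_isCyclicFlat h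
  rw [← hqp, hD.toMatroid_eRk hq] at h'
  have : q = p := Prod.ext (Finset.coe_injective hqp) (by exact_mod_cast h')
  exact this ▸ hq

theorem IsFlag.isNestedMatroid_toMatroid (hD : IsFlag D) : IsNestedMatroid hD.toMatroid := by
  intro F hF G hG hFG
  obtain ⟨p, hp, rfl⟩ := hD.exists_eq_of_isCyclicFlat hF
  obtain ⟨q, hq, rfl⟩ := hD.exists_eq_of_isCyclicFlat hG
  rcases hD.lt_or_lt p hp q hq (by rintro rfl; exact hFG rfl) with h | h
  · exact Or.inl (Finset.coe_subset.2 h.1.1)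
  · exact Or.inr (Finset.coe_subset.2 h.1.1)

end MatroidOfFlag

open Classical in
theorem image_flagOf_nestedMatroids (r n : ℕ) :
    flagOf '' nestedMatroids r n =
      (((Finset.univ.filter fun F : Finset (Fin n) => n - F.card ≤ r).biUnion
        fun F => flagsTo (F, r - (n - F.card)) : Finset (Finset (Finset (Fin n) × ℕ))) :
          Set (Finset (Finset (Fin n) × ℕ))) := by
  ext D
  simp only [Set.mem_image, Finset.mem_coe, Finset.mem_biUnion, Finset.mem_filter,
    Finset.mem_univ, true_and]
  constructor
  · rintro ⟨M, ⟨hE, hl, hr, hn⟩, rfl⟩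
    have hflag := isFlag_flagOf hl hn
    obtain ⟨p, hp⟩ := hflag.exists_isFlagTop
    have h := eRank_of_isFlagTop hE hp
    rw [hr, Fintype.card_fin] at h
    have h' : r = p.2 + (n - p.1.card) := by exact_mod_cast h
    refine ⟨p.1, by omega, mem_flagsTo.2 ⟨hflag, ?_⟩⟩
    rwa [show r - (n - p.1.card) = p.2 by omega]
  · rintro ⟨F, hF, hD⟩
    rw [mem_flagsTo] at hD
    refine ⟨hD.1.toMatroid, ⟨rfl, hD.1.toMatroid_loopless, ?_, hD.1.isNestedMatroid_toMatroid⟩,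
      hD.1.flagOf_toMatroid⟩
    have h := eRank_of_isFlagTop hD.1.toMatroid_E (hD.1.flagOf_toMatroid.symm ▸ hD.2)
    rw [h, Fintype.card_fin]
    dsimp only
    rw [Nat.sub_add_cancel hF]

theorem numNested_eq_sum (r n : ℕ) :
    numNested r n = ∑ F : Finset (Fin n),
      if n - F.card ≤ r then (flagsTo (F, r - (n - F.card))).card else 0 := by
  classical
  rw [numNested, ← Set.InjOn.ncard_image (f := flagOf)
    (fun M hM N hN h => eq_of_flagOf_eq (hM.1.trans hN.1.symm) h), image_flagOf_nestedMatroids,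
    Set.ncard_coe_finset, Finset.card_biUnion, Finset.sum_filter]
  intro F _ G _ hFG
  refine Finset.disjoint_left.2 fun D hD hD' => hFG ?_
  exact congrArg Prod.fst ((mem_flagsTo.1 hD).2.unique (mem_flagsTo.1 hD').2)

theorem mainTheorem3 (n r : ℕ) (hr : 1 ≤ r) (hrn : r ≤ n) :
    numNested r n = eulerianNumber (r - 1) n := by
  obtain ⟨n, rfl⟩ : ∃ m, n = m + 1 := ⟨n - 1, by omega⟩
  have h := congrArg (PowerSeries.coeff r) (sum_X_pow_mul_flagSeriesOf n)
  obtain ⟨k, rfl⟩ : ∃ k, r = k + 1 := ⟨r - 1, by omega⟩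
  rw [coeff_eulerianSeries, map_sum] at h
  rw [Nat.add_sub_cancel, ← Nat.cast_inj (R := ℚ), ← h, numNested_eq_sum, Nat.cast_sum]
  refine Finset.sum_congr rfl fun F _ => ?_
  rw [PowerSeries.coeff_X_pow_mul', Nat.cast_ite, Nat.cast_zero]
  simp [flagSeriesOf]
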